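/- For an additive category $\mathcal C$ let $\operatorname{mod}\mathcal C$ denote the category of finitely presented functors, that is, of the additive functors $F\colon\mathcal C^{\mathrm{op}}\to\mathrm{Ab}$ that admit an exact presentation $\operatorname{Hom}(-,X)\to\operatorname{Hom}(-,Y)\to F\to 0$ with $X,Y\in\mathcal C$. Every additive functor $g\colon\mathcal C\to\mathcal D$ into an additive category with cokernels extends along the Yoneda functor $\mathcal C\to\operatorname{mod}\mathcal C$, $X\mapsto\operatorname{Hom}(-,X)$, to a right exact functor $\operatorname{mod}\mathcal C\to\mathcal D$, unique up to isomorphism; it sends $\operatorname{Coker}\operatorname{Hom}(-,\phi)$ to $\operatorname{Coker} g(\phi)$. Let $\mathcal A$ be an abelian category. The Yoneda functor $\mathcal A\to\operatorname{mod}\mathcal A$ has a left adjoint (the right exact extension $\operatorname{mod}\mathcal A\to\mathcal A$ of the identity), and $\operatorname{eff}\mathcal A\subseteq\operatorname{mod}\mathcal A$ denotes the full subcategory of effaceable functors, i.e. those sent to zero by this left adjoint. Let $i\colon\mathcal C\to\mathcal A$ be the inclusion of a full additive subcategory, let $i^*\colon\operatorname{mod}\mathcal C\to\operatorname{mod}\mathcal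 A$ be the right exact functor extending $\mathcal C\xrightarrow{i}\mathcal A\to\operatorname{mod}\mathcal A$, and let $\operatorname{eff}(\mathcal A,\mathcal C)\subseteq\operatorname{mod}\mathcal C$ be the full subcategory of those $F$ with $i^*F\in\operatorname{eff}\mathcal A$. One says that $\mathcal C$ generates $\mathcal A$ if every object $X\in\mathcal A$ admits an epimorphism $C\to X$ with $C\in\mathcal C$. **Proposition (relative Auslander formula).** Let $\mathcal A$ be an abelian category and $\mathcal C\subseteq\mathcal A$ a full additive subcategory such that $\operatorname{mod}\mathcal C$ is abelian. Then $\mathcal C$ generates $\mathcal A$ if and only if the right exact functor $E\colon\operatorname{mod}\mathcal C\to\mathcal A$ extending the inclusion $\mathcal C\to\mathcal A$ is exact, $\operatorname{eff}(\mathcal A,\mathcal C)$ is a Serre subcategory of $\operatorname{mod}\mathcal C$, and $E$ induces an equivalence $$(\operatorname{mod}\mathcal C)/\operatorname{eff}(\mathcal A,\mathcal C)\xrightarrow{\ \sim\ }\mathcal A$$ from the Serre quotient, i.e. the localization of $\operatorname{mod}\mathcal C$ at the morphisms whose kernel and cokernel lie in $\operatorname{eff}(\mathcal A,\mathcal C)$.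 -/

import Mathlib

open CategoryTheory CategoryTheory.Limits Opposite

universe v v' u u'

noncomputable section

namespace CoherentFunctor

section Basic

variable {C : Type u} [Category.{v} C] [Preadditive C]

/-- A presentation `Hom(-, X) ⟶ Hom(-, Y) ⟶ F ⟶ 0` (exact in the category of functors) of a
functor `F : Cᵒᵖ ⥤ Ab`. -/
structure Presentation (F : Cᵒᵖ ⥤ AddCommGrpCat.{v}) where
  X : C
  Y : C
  /-- the presenting morphism -/
  f : X ⟶ Y
  p : preadditiveYoneda.obj Y ⟶ F
  w : preadditiveYoneda.map f ≫ p = 0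
  exact : (ShortComplex.mk (preadditiveYoneda.map f) p w).Exact
  epi : Epi p

variable (C) in
/-- The finitely presented (or coherent) functors: the additive functors `Cᵒᵖ ⥤ Ab` which admit
a presentation by representable functors. -/
def isFinPres : ObjectProperty (Cᵒᵖ ⥤ AddCommGrpCat.{v}) :=
  fun F => F.Additive ∧ Nonempty (Presentation F)

variable (C) in
/-- The category `mod C` of finitely presented functors `Cᵒᵖ ⥤ Ab`, a full subcategory of the
category of all functors. -/
def FPMod : Type (max u (v + 1)) := (isFinPres C).FullSubcategory

instance : Category.{max u v} (FPMod C) :=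
  inferInstanceAs (Category (isFinPres C).FullSubcategory)

variable (C) in
/-- The inclusion of `mod C` in the category of functors `Cᵒᵖ ⥤ Ab`. -/
def FPMod.ι : FPMod C ⥤ (Cᵒᵖ ⥤ AddCommGrpCat.{v}) := (isFinPres C).ι

instance : (FPMod.ι C).Full := inferInstanceAs (isFinPres C).ι.Full
instance : (FPMod.ι C).Faithful := inferInstanceAs (isFinPres C).ι.Faithful

/-- The category `mod C` as the target of functors. -/
def FPMod.lift {B : Type u'} [Category.{v'} B] (T : B ⥤ (Cᵒᵖ ⥤ AddCommGrpCat.{v}))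
    (hT : ∀ b, isFinPres C (T.obj b)) : B ⥤ FPMod C :=
  (isFinPres C).lift T hT

/-- A chosen presentation of an object of `mod C`. -/
def FPMod.pres (F : FPMod C) : Presentation ((FPMod.ι C).obj F) := F.property.2.some

instance : (preadditiveYoneda (C := C)).Additive where
  map_add {X Y f g} := by
    ext Z (x : Z.unop ⟶ X)
    exact Preadditive.comp_add _ _ _ x f g

namespace Presentation

variable {F : Cᵒᵖ ⥤ AddCommGrpCat.{v}} (P : Presentation F)

lemma exists_lift {Z : C} (q : preadditiveYoneda.obj Z ⟶ F) :
    ∃ b : Z ⟶ P.Y, preadditiveYoneda.map b ≫ P.p = q := by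
  have := P.epi
  have h : Function.Surjective (P.p.app (op Z)) :=
    (AddCommGrpCat.epi_iff_surjective _).1 inferInstance
  obtain ⟨b, hb⟩ := h (q.app (op Z) (𝟙 Z))
  let b' : Z ⟶ P.Y := b
  refine ⟨b', ?_⟩
  ext W (x : W.unop ⟶ Z)
  have h1 := ConcreteCategory.congr_hom (P.p.naturality x.op) b'
  have h2 := ConcreteCategory.congr_hom (q.naturality x.op) (𝟙 Z)
  change P.p.app W (x ≫ b') = _ at h1
  change q.app W (x ≫ 𝟙 Z) = _ at h2
  rw [Category.comp_id] at h2
  change P.p.app W (x ≫ b') = q.app W x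
  rw [h1, h2]
  change F.map x.op (P.p.app (op Z) b) = F.map x.op (q.app (op Z) (𝟙 Z))
  rw [hb]

lemma exists_factor {Z : C} (b : Z ⟶ P.Y) (hb : preadditiveYoneda.map b ≫ P.p = 0) :
    ∃ a : Z ⟶ P.X, a ≫ P.f = b := by
  have h := (ShortComplex.ab_exact_iff _).1 (P.exact.map ((evaluation _ _).obj (op Z))) b (by
    have := ConcreteCategory.congr_hom (NatTrans.congr_app hb (op Z)) (𝟙 Z)
    change P.p.app (op Z) (𝟙 Z ≫ b) = 0 at this
    rw [Category.id_comp] at this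
    exact this)
  exact h

/-- The cokernel of `Hom(-, f)` has `f` as a presenting morphism. -/
def ofCokernel {X Y : C} (f : X ⟶ Y) : Presentation (cokernel (preadditiveYoneda.map f)) where
  X := X
  Y := Y
  f := f
  p := cokernel.π _
  w := cokernel.condition _
  exact := ShortComplex.exact_cokernel _
  epi := inferInstance

/-- A representable functor is presented by `0 : Y ⟶ Y`. -/
def ofRepresentable (Y : C) : Presentation (preadditiveYoneda.obj Y) where
  X := Y
  Y := Y
  f := 0
  p := 𝟙 _
  w := by simp
  exact := (ShortComplex.exact_iff_mono _ (by simp)).2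
    (inferInstance : Mono (𝟙 (preadditiveYoneda.obj Y)))
  epi := inferInstance

end Presentation

lemma isFinPres_cokernel {X Y : C} (f : X ⟶ Y) :
    isFinPres C (cokernel (preadditiveYoneda.map f)) := by
  refine ⟨⟨fun {U V a b} => ?_⟩, ⟨Presentation.ofCokernel f⟩⟩
  have hs : Function.Surjective ((cokernel.π (preadditiveYoneda.map f)).app U) :=
    (AddCommGrpCat.epi_iff_surjective _).1 inferInstance
  ext x
  obtain ⟨y, rfl⟩ := hs x
  have h (c : U ⟶ V) := ConcreteCategory.congr_hom
    ((cokernel.π (preadditiveYoneda.map f)).naturality c) y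
  simp only [ConcreteCategory.comp_apply] at h
  change _ = (cokernel (preadditiveYoneda.map f)).map a _ +
    (cokernel (preadditiveYoneda.map f)).map b _
  rw [← h, ← h, ← h, ← map_add, Functor.map_add]
  rfl

variable (C) in
/-- The Yoneda functor `C ⥤ mod C`. -/
def yonedaMod : C ⥤ FPMod C :=
  FPMod.lift preadditiveYoneda (fun Y => ⟨inferInstance, ⟨Presentation.ofRepresentable Y⟩⟩)

end Basic

section Extension

variable {C : Type u} [Category.{v} C] [Preadditive C]
  {D : Type u'} [Category.{v'} D] [Preadditive D]

/-- A morphism `b` between the targets of the chosen presenting morphisms *covers* `η : F ⟶ F'`. -/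
def Covers {F F' : FPMod C} (η : F ⟶ F') (b : F.pres.Y ⟶ F'.pres.Y) : Prop :=
  preadditiveYoneda.map b ≫ F'.pres.p = F.pres.p ≫ (FPMod.ι C).map η

lemma exists_covers {F F' : FPMod C} (η : F ⟶ F') : ∃ b, Covers η b :=
  F'.pres.exists_lift _

lemma Covers.id (F : FPMod C) : Covers (𝟙 F) (𝟙 _) := by
  simp [Covers]

lemma Covers.comp {F F' F'' : FPMod C} {η : F ⟶ F'} {η' : F' ⟶ F''} {b b'}
    (h : Covers η b) (h' : Covers η' b') : Covers (η ≫ η') (b ≫ b') := by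
  unfold Covers at *
  rw [Functor.map_comp, Category.assoc, h', reassoc_of% h, Functor.map_comp]

variable (G : C ⥤ D) [HasCokernels D]

lemma Covers.condition {F F' : FPMod C} {η : F ⟶ F'} {b} (h : Covers η b) :
    G.map F.pres.f ≫ G.map b ≫ cokernel.π (G.map F'.pres.f) = 0 := by
  obtain ⟨a, ha⟩ := F'.pres.exists_factor (F.pres.f ≫ b) (by
    rw [Functor.map_comp, Category.assoc, h, reassoc_of% F.pres.w, zero_comp])
  rw [← Category.assoc, ← G.map_comp, ← ha, G.map_comp, Category.assoc, cokernel.condition,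
    comp_zero]

variable [G.Additive]

lemma Covers.unique {F F' : FPMod C} {η : F ⟶ F'} {b b'} (h : Covers η b) (h' : Covers η b') :
    G.map b ≫ cokernel.π (G.map F'.pres.f) = G.map b' ≫ cokernel.π (G.map F'.pres.f) := by
  obtain ⟨a, ha⟩ := F'.pres.exists_factor (b - b') (by
    rw [Functor.map_sub, Preadditive.sub_comp, h, h', sub_self])
  rw [← sub_eq_zero, ← Preadditive.sub_comp, ← G.map_sub, ← ha, G.map_comp, Category.assoc,
    cokernel.condition, comp_zero]

/-- The map `Coker G(f) ⟶ Coker G(f')` induced by `η : Coker Hom(-, f) ⟶ Coker Hom(-, f')`. -/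
def extendMap {F F' : FPMod C} (η : F ⟶ F') :
    cokernel (G.map F.pres.f) ⟶ cokernel (G.map F'.pres.f) :=
  cokernel.desc _ (G.map (exists_covers η).choose ≫ cokernel.π _)
    ((exists_covers η).choose_spec.condition G)

lemma π_extendMap {F F' : FPMod C} {η : F ⟶ F'} {b} (h : Covers η b) :
    cokernel.π (G.map F.pres.f) ≫ extendMap G η = G.map b ≫ cokernel.π _ := by
  rw [extendMap, cokernel.π_desc]
  exact (exists_covers η).choose_spec.unique G h

/-- The right exact functor `mod C ⥤ D` extending an additive functor `G : C ⥤ D` to a category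
with cokernels: it sends `Coker Hom(-, f)` to `Coker G(f)`. -/
def extend : FPMod C ⥤ D where
  obj F := cokernel (G.map F.pres.f)
  map η := extendMap G η
  map_id F := by
    rw [← cancel_epi (cokernel.π _), π_extendMap G (Covers.id F)]
    simp
  map_comp {F F' F''} η η' := by
    obtain ⟨b, hb⟩ := exists_covers η
    obtain ⟨b', hb'⟩ := exists_covers η'
    rw [← cancel_epi (cokernel.π _), π_extendMap G (hb.comp hb'), ← Category.assoc,
      π_extendMap G hb, Category.assoc, π_extendMap G hb', G.map_comp, Category.assoc]

/-- The cokernel projection `G(Y) ⟶ Coker G(f)`, where `f : X ⟶ Y` presents `F`. -/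
def extendπ (F : FPMod C) : G.obj F.pres.Y ⟶ (extend G).obj F := cokernel.π (G.map F.pres.f)

instance (F : FPMod C) : Epi (extendπ G F) :=
  inferInstanceAs (Epi (cokernel.π (G.map F.pres.f)))

/-- The universal property of `Coker G(f)`. -/
def extendDesc {F : FPMod C} {T : D} (x : G.obj F.pres.Y ⟶ T) (hx : G.map F.pres.f ≫ x = 0) :
    (extend G).obj F ⟶ T := cokernel.desc _ x hx

lemma extendπ_desc {F : FPMod C} {T : D} (x : G.obj F.pres.Y ⟶ T)
    (hx : G.map F.pres.f ≫ x = 0) : extendπ G F ≫ extendDesc G x hx = x :=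
  cokernel.π_desc _ _ _

lemma map_f_extendπ (F : FPMod C) : G.map F.pres.f ≫ extendπ G F = 0 :=
  cokernel.condition _

lemma extendπ_map {F F' : FPMod C} {η : F ⟶ F'} {b} (h : Covers η b) :
    extendπ G F ≫ (extend G).map η = G.map b ≫ extendπ G F' :=
  π_extendMap G h

lemma Covers.extendπ_eq {F F' : FPMod C} {η : F ⟶ F'} {b b'} (h : Covers η b)
    (h' : Covers η b') : G.map b ≫ extendπ G F' = G.map b' ≫ extendπ G F' :=
  h.unique G h'

/-- The presentation map of a representable functor, as a morphism of `C`. -/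
def repHom (Y : C) : ((yonedaMod C).obj Y).pres.Y ⟶ Y :=
  preadditiveYoneda.preimage ((yonedaMod C).obj Y).pres.p

lemma map_repHom (Y : C) :
    preadditiveYoneda.map (repHom Y) = ((yonedaMod C).obj Y).pres.p :=
  preadditiveYoneda.map_preimage _

/-- The value of `extend G` at a representable functor. -/
def extendYonedaIso (Y : C) : (extend G).obj ((yonedaMod C).obj Y) ≅ G.obj Y where
  hom := extendDesc G (G.map (repHom Y)) (by
    rw [← G.map_comp, ← G.map_zero]
    congr 1
    apply preadditiveYoneda.map_injective
    rw [Functor.map_comp, map_repHom, Functor.map_zero]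
    exact ((yonedaMod C).obj Y).pres.w)
  inv := G.map (((yonedaMod C).obj Y).pres.exists_lift (𝟙 (preadditiveYoneda.obj Y))).choose ≫
    extendπ G _
  hom_inv_id := by
    have h := (((yonedaMod C).obj Y).pres.exists_lift (𝟙 (preadditiveYoneda.obj Y))).choose_spec
    generalize Exists.choose _ = t at h ⊢
    have h1 : Covers (𝟙 ((yonedaMod C).obj Y)) (repHom Y ≫ t) := by
      unfold Covers
      rw [Functor.map_comp, Category.assoc, h, map_repHom, CategoryTheory.Functor.map_id]
      rfl
    rw [← cancel_epi (extendπ G _), ← Category.assoc, extendπ_desc, ← Category.assoc,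
      ← G.map_comp, h1.extendπ_eq G (Covers.id _), G.map_id, Category.id_comp, Category.comp_id]
  inv_hom_id := by
    have h := (((yonedaMod C).obj Y).pres.exists_lift (𝟙 (preadditiveYoneda.obj Y))).choose_spec
    generalize Exists.choose _ = t at h ⊢
    rw [Category.assoc, extendπ_desc, ← G.map_comp, ← G.map_id]
    congr 1
    apply preadditiveYoneda.map_injective
    rw [Functor.map_comp, map_repHom, CategoryTheory.Functor.map_id]
    exact h

/-- `extend G` extends `G` along the Yoneda functor. -/
def yonedaModCompExtend : yonedaMod C ⋙ extend G ≅ G :=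
  NatIso.ofComponents (extendYonedaIso G) (fun {Y Y'} g => by
    obtain ⟨b, hb⟩ := exists_covers ((yonedaMod C).map g)
    dsimp only [extendYonedaIso, Functor.comp_obj, Functor.comp_map]
    rw [← cancel_epi (extendπ G _), ← Category.assoc, extendπ_map G hb, Category.assoc,
      extendπ_desc, ← Category.assoc, extendπ_desc, ← G.map_comp, ← G.map_comp]
    congr 1
    apply preadditiveYoneda.map_injective
    rw [Functor.map_comp, Functor.map_comp, map_repHom, map_repHom]
    exact hb)

end Extension

section Effaceable

variable {A : Type u} [Category.{v} A] [Abelian A]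

lemma Presentation.exists_desc {F : Aᵒᵖ ⥤ AddCommGrpCat.{v}} (P : Presentation F)
    {T : Aᵒᵖ ⥤ AddCommGrpCat.{v}} (x : preadditiveYoneda.obj P.Y ⟶ T)
    (hx : preadditiveYoneda.map P.f ≫ x = 0) : ∃ q : F ⟶ T, P.p ≫ q = x :=
  have := P.epi
  ⟨P.exact.desc x hx, P.exact.g_desc x hx⟩

lemma exists_hom_yonedaMod (F : FPMod A) (X : A) (θ : (extend (𝟭 A)).obj F ⟶ X) :
    ∃ q : F ⟶ (yonedaMod A).obj X,
      F.pres.p ≫ (FPMod.ι A).map q = preadditiveYoneda.map (extendπ (𝟭 A) F ≫ θ) := by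
  obtain ⟨q, hq⟩ := F.pres.exists_desc (preadditiveYoneda.map (extendπ (𝟭 A) F ≫ θ)) (by
    rw [← Functor.map_comp, ← Category.assoc]
    erw [map_f_extendπ (𝟭 A) F]
    rw [zero_comp, Functor.map_zero])
  obtain ⟨q', rfl⟩ := (FPMod.ι A).map_surjective (Y := (yonedaMod A).obj X) q
  exact ⟨q', hq⟩

/-- The bijection `Hom(Coker f, X) ≃ Hom(F, Hom(-, X))` for `F = Coker Hom(-, f)`. -/
def extendIdHomEquiv (F : FPMod A) (X : A) :
    ((extend (𝟭 A)).obj F ⟶ X) ≃ (F ⟶ (yonedaMod A).obj X) :=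
  Equiv.ofBijective (fun θ => (exists_hom_yonedaMod F X θ).choose) (by
    constructor
    · intro θ θ' h
      have h1 := (exists_hom_yonedaMod F X θ).choose_spec
      have h2 := (exists_hom_yonedaMod F X θ').choose_spec
      dsimp only at h
      rw [h, h2] at h1
      exact ((cancel_epi (extendπ (𝟭 A) F)).1 (preadditiveYoneda.map_injective h1)).symm
    · intro q
      let x : F.pres.Y ⟶ X := preadditiveYoneda.preimage (F.pres.p ≫ (FPMod.ι A).map q)
      have hx : preadditiveYoneda.map x = F.pres.p ≫ (FPMod.ι A).map q :=
        preadditiveYoneda.map_preimage _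
      refine ⟨extendDesc (𝟭 A) x ?_, ?_⟩
      · apply preadditiveYoneda.map_injective
        change preadditiveYoneda.map (F.pres.f ≫ x) = _
        rw [Functor.map_comp, hx, Functor.map_zero]
        exact (Category.assoc _ _ _).symm.trans ((congrArg (· ≫ _) F.pres.w).trans zero_comp)
      · have h1 := (exists_hom_yonedaMod F X (extendDesc (𝟭 A) x ?_)).choose_spec.trans
          (congrArg preadditiveYoneda.map (extendπ_desc (𝟭 A) x _))
        have := F.pres.epi
        apply (FPMod.ι A).map_injective
        rw [← cancel_epi F.pres.p]
        exact h1.trans hx)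

lemma p_extendIdHomEquiv (F : FPMod A) (X : A) (θ : (extend (𝟭 A)).obj F ⟶ X) :
    F.pres.p ≫ (FPMod.ι A).map (extendIdHomEquiv F X θ) =
      preadditiveYoneda.map (extendπ (𝟭 A) F ≫ θ) :=
  (exists_hom_yonedaMod F X θ).choose_spec

variable (A) in
/-- The left adjoint of the Yoneda functor `A ⥤ mod A` of an abelian category is the right exact
functor `mod A ⥤ A` extending the identity. -/
def extendIdAdjunction : extend (𝟭 A) ⊣ yonedaMod A :=
  Adjunction.mkOfHomEquiv
    { homEquiv := extendIdHomEquiv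
      homEquiv_naturality_left_symm := fun {F' F X} η q => by
        obtain ⟨θ, rfl⟩ := (extendIdHomEquiv F X).surjective q
        rw [Equiv.symm_apply_apply, Equiv.symm_apply_eq]
        apply (FPMod.ι A).map_injective
        have := F'.pres.epi
        obtain ⟨b, hb⟩ := exists_covers η
        rw [← cancel_epi F'.pres.p, p_extendIdHomEquiv, ← Category.assoc (extendπ _ _),
          extendπ_map _ hb, Functor.map_comp (FPMod.ι A), ← Category.assoc, ← hb,
          Category.assoc, p_extendIdHomEquiv, Category.assoc]
        exact (preadditiveYoneda.map_comp b _).symm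
      homEquiv_naturality_right := fun {F X X'} θ g => by
        apply (FPMod.ι A).map_injective
        have := F.pres.epi
        rw [← cancel_epi F.pres.p, p_extendIdHomEquiv, Functor.map_comp (FPMod.ι A),
          ← Category.assoc, ← Category.assoc, p_extendIdHomEquiv]
        exact preadditiveYoneda.map_comp (extendπ (𝟭 A) F ≫ θ) g }

variable (A) in
/-- `eff A`: the effaceable functors, i.e. the objects of `mod A` which are sent to zero by the
left adjoint of the Yoneda functor `A ⥤ mod A`, see `extendIdAdjunction`. -/
def eff : ObjectProperty (FPMod A) := fun F => IsZero ((extend (𝟭 A)).obj F)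

variable (P : ObjectProperty A)

/-- The functor `i^* : mod C ⥤ mod A` extending the inclusion `i : C ⥤ A` of the full subcategory
`C` of the objects satisfying `P`; it sends `Coker Hom(-, f)` to `Coker Hom(-, i(f))`. -/
def inclMod : FPMod P.FullSubcategory ⥤ FPMod A :=
  FPMod.lift (extend (P.ι ⋙ preadditiveYoneda))
    (fun F => isFinPres_cokernel (P.ι.map F.pres.f))

/-- `eff(A, C) = mod C ∩ eff A`, where `mod C` is viewed as a subcategory of `mod A`
through `i^*`. -/
def effRel : ObjectProperty (FPMod P.FullSubcategory) := (eff A).inverseImage (inclMod P)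

/-- The full subcategory of the objects satisfying `P` generates `A`: every object `X` of `A`
admits an epimorphism `Y ⟶ X` with `Y` satisfying `P`. -/
def Generates : Prop := ∀ X : A, ∃ (Y : A) (g : Y ⟶ X), P Y ∧ Epi g

end Effaceable

end CoherentFunctor

end

/-!
Write `E` for the right exact functor `mod C ⥤ A` extending the inclusion `C ⥤ A`, and think of the
epimorphisms of `A` as coverings. If `C` generates `A`, then every `T ⟶ E(F)` lifts, on a covering
of `T` by an object `c` of `C`, to an element of `F(c)`, and an element of `F(c)` which becomes zero
in `E(F)` vanishes on a covering of `c` by an object of `C`. As the representable functors are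
projective in `mod C`, it follows that `E` is exact. The kernel of `E` is `eff(A, C)`, so `E`
induces a faithful exact functor on the Serre quotient. This functor is full, because a morphism
`θ : E(F) ⟶ E(F')` satisfies `E(x) ≫ θ = E(x')` for some `x` and `x'` with `E(x)` epi, and then
`x'` descends along `x` in the quotient. Conversely, every `E(F)` is a quotient of an object of `C`.
-/

namespace CoherentFunctor

section SerreQuotient

variable {B : Type u} [Category.{v} B] [Abelian B] {D : Type u'} [Category.{v'} D]

lemma faithful_of_isZero_of_isZero_obj [Preadditive D] (Φ : B ⥤ D) [Φ.Additive]
    [Φ.PreservesMonomorphisms] [Φ.PreservesEpimorphisms]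
    (hΦ : ∀ X, IsZero (Φ.obj X) → IsZero X) : Φ.Faithful := by
  refine ⟨fun {X Y} f g hfg => ?_⟩
  rw [← sub_eq_zero] at hfg ⊢
  rw [← Φ.map_sub, ← Abelian.image.fac (f - g), Φ.map_comp] at hfg
  have hker : IsZero (Φ.obj (Abelian.image (f - g))) :=
    IsZero.of_epi_eq_zero _ (zero_of_comp_mono _ hfg)
  rw [← Abelian.image.fac (f - g), (hΦ _ hker).eq_of_src (Abelian.image.ι _) 0, comp_zero]

lemma exists_map_eq_of_epi_map [HasZeroMorphisms D] (Φ : B ⥤ D) [Φ.PreservesZeroMorphisms]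
    [Φ.Faithful] {X Y Z : B} {θ : Φ.obj X ⟶ Φ.obj Y} (x : Z ⟶ X) (x' : Z ⟶ Y) [Epi (Φ.map x)]
    (h : Φ.map x ≫ θ = Φ.map x') : ∃ f : X ⟶ Y, Φ.map f = θ := by
  have : Epi x := Φ.epi_of_epi_map inferInstance
  have hx' : kernel.ι x ≫ x' = 0 := Φ.map_injective <| by
    rw [Φ.map_comp, ← h, ← Category.assoc, ← Φ.map_comp, kernel.condition, Φ.map_zero, zero_comp,
      Φ.map_zero]
  refine ⟨Abelian.epiDesc x x' hx', ?_⟩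
  rw [← cancel_epi (Φ.map x), ← Φ.map_comp, Abelian.comp_epiDesc, h]

theorem isLocalization_isoModSerre_kernel [Abelian D] (E : B ⥤ D) [PreservesFiniteLimits E]
    [PreservesFiniteColimits E] [E.EssSurj]
    (hE : ∀ ⦃X Y : B⦄ (θ : E.obj X ⟶ E.obj Y), ∃ (Z : B) (x : Z ⟶ X) (x' : Z ⟶ Y),
      Epi (E.map x) ∧ E.map x ≫ θ = E.map x') :
    E.IsLocalization E.kernel.isoModSerre := by
  let Q := E.kernel.isoModSerre.Q
  have hinv : E.kernel.isoModSerre.IsInvertedBy E :=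
    (E.kernel.isoModSerre_isInvertedBy_iff E).2 le_rfl
  let Φ := Localization.lift E hinv Q
  let e : Q ⋙ Φ ≅ E := Localization.fac E hinv Q
  let _ := ObjectProperty.SerreClassLocalization.abelian Q E.kernel
  have : Q.EssSurj := Localization.essSurj Q E.kernel.isoModSerre
  have : PreservesFiniteLimits Φ :=
    (ObjectProperty.SerreClassLocalization.preservesFiniteLimits_comp_iff Q E.kernel Φ).1
      (preservesFiniteLimits_of_natIso e.symm)
  have : PreservesFiniteColimits Φ :=
    (ObjectProperty.SerreClassLocalization.preservesFiniteColimits_comp_iff Q E.kernel Φ).1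
      (preservesFiniteColimits_of_natIso e.symm)
  have : Φ.Additive := Φ.additive_of_preserves_binary_products
  have : Φ.Faithful := faithful_of_isZero_of_isZero_obj Φ fun X hX => by
    have hker : E.kernel (Q.objPreimage X) :=
      hX.of_iso ((e.app _).symm ≪≫ Φ.mapIso (Q.objObjPreimageIso X))
    exact ((ObjectProperty.SerreClassLocalization.isZero_obj_iff Q E.kernel _).2 hker).of_iso
      (Q.objObjPreimageIso X).symm
  have : Φ.Full := Φ.full_of_comp_essSurj Q fun X Y θ => by
    obtain ⟨Z, x, x', _, h⟩ := hE (e.inv.app X ≫ θ ≫ e.hom.app Y)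
    have : Epi (Φ.map (Q.map x)) :=
      ((MorphismProperty.epimorphisms D).arrow_mk_iso_iff
        ((Functor.mapArrowFunctor _ _).mapIso e |>.app (Arrow.mk x))).2 ‹_›
    refine exists_map_eq_of_epi_map Φ (Q.map x) (Q.map x') ?_
    have hx : Φ.map (Q.map x) = e.hom.app Z ≫ E.map x ≫ e.inv.app X := by
      rw [← e.hom.naturality_assoc, e.hom_inv_id_app, Category.comp_id, Functor.comp_map]
    rw [← cancel_mono (e.hom.app Y), hx, Category.assoc, Category.assoc, Category.assoc, h]
    exact (e.hom.naturality x').symm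
  have : Φ.EssSurj :=
    ⟨fun X => ⟨Q.obj (E.objPreimage X), ⟨e.app _ ≪≫ E.objObjPreimageIso X⟩⟩⟩
  have : Φ.IsEquivalence := { }
  exact .of_equivalence_target Q _ E Φ.asEquivalence e

end SerreQuotient

section FinitelyPresented

variable {C : Type u} [Category.{v} C] [Preadditive C]

lemma Presentation.epi_f_iff {F : Cᵒᵖ ⥤ AddCommGrpCat.{v}} (p : Presentation F) :
    Epi p.f ↔ ∀ (X : C) (θ : F ⟶ preadditiveYoneda.obj X), θ = 0 := by
  have := p.epi
  rw [Preadditive.epi_iff_cancel_zero]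
  refine ⟨fun hf X θ => ?_, fun hF X u hu => ?_⟩
  · obtain ⟨u, hu⟩ := preadditiveYoneda.map_surjective (p.p ≫ θ)
    have hfu : p.f ≫ u = 0 := preadditiveYoneda.map_injective <| by
      rw [Functor.map_comp, hu, reassoc_of% p.w, zero_comp, Functor.map_zero]
    rw [← cancel_epi p.p, ← hu, hf X u hfu, Functor.map_zero, comp_zero]
  · have hu' : preadditiveYoneda.map p.f ≫ preadditiveYoneda.map u = 0 := by
      rw [← Functor.map_comp, hu, Functor.map_zero]
    apply preadditiveYoneda.map_injective
    rw [← p.exact.g_desc _ hu', hF X (p.exact.desc _ hu'), comp_zero, Functor.map_zero]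

instance : (yonedaMod C).Full :=
  .of_comp_faithful_iso (G := FPMod.ι C) (Iso.refl preadditiveYoneda)

/-- The epimorphism `Hom(-, Y) ⟶ F` of the chosen presentation of `F`, as a morphism of `mod C`. -/
noncomputable def presHom (F : FPMod C) : (yonedaMod C).obj F.pres.Y ⟶ F :=
  (FPMod.ι C).preimage F.pres.p

lemma ι_map_presHom (F : FPMod C) : (FPMod.ι C).map (presHom F) = F.pres.p :=
  (FPMod.ι C).map_preimage _

instance (F : FPMod C) : Epi (presHom F) :=
  (FPMod.ι C).epi_of_epi_map (by rw [ι_map_presHom]; exact F.pres.epi)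

lemma exists_yonedaMod_map_presHom {c : C} {F : FPMod C} (x : (yonedaMod C).obj c ⟶ F) :
    ∃ b : c ⟶ F.pres.Y, (yonedaMod C).map b ≫ presHom F = x := by
  obtain ⟨b, hb⟩ := F.pres.exists_lift ((FPMod.ι C).map x)
  refine ⟨b, (FPMod.ι C).map_injective ?_⟩
  rw [Functor.map_comp, ι_map_presHom]
  exact hb

lemma covers_iff {F F' : FPMod C} (η : F ⟶ F') (b : F.pres.Y ⟶ F'.pres.Y) :
    Covers η b ↔ (yonedaMod C).map b ≫ presHom F' = presHom F ≫ η := by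
  rw [← (FPMod.ι C).map_injective.eq_iff, Functor.map_comp, Functor.map_comp, ι_map_presHom,
    ι_map_presHom]
  rfl

-- Test the epimorphism against `0` and the projection to `Coker Hom(-, g)`, which lies in `mod C`.
lemma exists_comp_eq_id_of_epi_yonedaMod_map {b c : C} (g : b ⟶ c) [Epi ((yonedaMod C).map g)] :
    ∃ s : c ⟶ b, s ≫ g = 𝟙 c := by
  let Q : FPMod C := ⟨_, isFinPres_cokernel g⟩
  obtain ⟨π, hπ⟩ := (FPMod.ι C).map_surjective (X := (yonedaMod C).obj c) (Y := Q)
    (cokernel.π (preadditiveYoneda.map g))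
  obtain ⟨o, ho⟩ := (FPMod.ι C).map_surjective (X := (yonedaMod C).obj c) (Y := Q) 0
  have hπo : π = o := by
    rw [← cancel_epi ((yonedaMod C).map g)]
    apply (FPMod.ι C).map_injective
    rw [Functor.map_comp, Functor.map_comp, hπ, ho, comp_zero]
    exact cokernel.condition _
  have hπ₀ : cokernel.π (preadditiveYoneda.map g) = 0 := by rw [← hπ, hπo, ho]; rfl
  exact (Presentation.ofCokernel g).exists_factor (𝟙 c) ((_ ≫= hπ₀).trans comp_zero)

instance projective_yonedaMod_obj [Abelian (FPMod C)] (c : C) :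
    Projective ((yonedaMod C).obj c) where
  factors {F' F} x η _ := by
    obtain ⟨g, hg⟩ := (yonedaMod C).map_surjective (presHom (pullback x η) ≫ pullback.fst x η)
    have : Epi ((yonedaMod C).map g) := by rw [hg]; infer_instance
    obtain ⟨s, hs⟩ := exists_comp_eq_id_of_epi_yonedaMod_map g
    refine ⟨(yonedaMod C).map s ≫ presHom _ ≫ pullback.snd x η, ?_⟩
    rw [Category.assoc, Category.assoc, ← pullback.condition, ← Category.assoc (presHom _), ← hg,
      ← Category.assoc, ← Functor.map_comp, hs, (yonedaMod C).map_id, Category.id_comp]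

section Additive

variable [inst : Preadditive (FPMod C)] [HasBinaryBiproducts (FPMod C)]

-- Any additive structure on `mod C` is the one inherited from the functor category, because a
-- category with binary biproducts has at most one.
instance : (FPMod.ι C).Additive := by
  obtain rfl : inst = inferInstanceAs (Preadditive (isFinPres C).FullSubcategory) :=
    Subsingleton.elim _ _
  exact inferInstanceAs (isFinPres C).ι.Additive

instance : (yonedaMod C).Additive where
  map_add := (FPMod.ι C).map_injective <| by
    rw [(FPMod.ι C).map_add]
    exact preadditiveYoneda.map_add

lemma yonedaMod_map_f_presHom (F : FPMod C) : (yonedaMod C).map F.pres.f ≫ presHom F = 0 := by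
  apply (FPMod.ι C).map_injective
  rw [Functor.map_comp, ι_map_presHom, Functor.map_zero]
  exact F.pres.w

end Additive

end FinitelyPresented

section Extension

variable {C : Type u} [Category.{v} C] [Preadditive C]
  {D : Type u'} [Category.{v'} D] [Preadditive D] [HasCokernels D] (G : C ⥤ D) [G.Additive]

lemma isZero_extend_obj_iff (F : FPMod C) :
    IsZero ((extend G).obj F) ↔ Epi (G.map F.pres.f) :=
  ⟨Preadditive.epi_of_isZero_cokernel _, fun _ => isZero_cokernel_of_epi _⟩

instance [Preadditive (FPMod C)] [HasBinaryBiproducts (FPMod C)] : (extend G).Additive where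
  map_add {F F' η η'} := by
    obtain ⟨b, hb⟩ := exists_covers η
    obtain ⟨b', hb'⟩ := exists_covers η'
    have h : Covers (η + η') (b + b') := by
      rw [covers_iff] at hb hb' ⊢
      rw [Functor.map_add, Preadditive.add_comp, hb, hb', Preadditive.comp_add]
    rw [← cancel_epi (extendπ G F), extendπ_map G h, Preadditive.comp_add, extendπ_map G hb,
      extendπ_map G hb', G.map_add, Preadditive.add_comp]

/-- The morphism `G(c) ⟶ extend G F` induced by an element of `F(c)`, the element being given in
its Yoneda form `Hom(-, c) ⟶ F`. -/
noncomputable def toExtend {c : C} {F : FPMod C} (x : (yonedaMod C).obj c ⟶ F) :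
    G.obj c ⟶ (extend G).obj F :=
  (yonedaModCompExtend G).inv.app c ≫ (extend G).map x

lemma extend_map_eq {c : C} {F : FPMod C} (x : (yonedaMod C).obj c ⟶ F) :
    (extend G).map x = (yonedaModCompExtend G).hom.app c ≫ toExtend G x :=
  ((yonedaModCompExtend G).hom_inv_id_app_assoc c ((extend G).map x)).symm

lemma toExtend_comp {c : C} {F F' : FPMod C} (x : (yonedaMod C).obj c ⟶ F) (η : F ⟶ F') :
    toExtend G (x ≫ η) = toExtend G x ≫ (extend G).map η := by
  simp only [toExtend, Functor.map_comp, Category.assoc]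

lemma toExtend_map_comp {c c' : C} {F : FPMod C} (a : c' ⟶ c) (x : (yonedaMod C).obj c ⟶ F) :
    toExtend G ((yonedaMod C).map a ≫ x) = G.map a ≫ toExtend G x := by
  simp only [toExtend, Functor.map_comp]
  exact ((yonedaModCompExtend G).inv.naturality_assoc a _).symm

lemma toExtend_presHom (F : FPMod C) : toExtend G (presHom F) = extendπ G F := by
  have hcovers : Covers (presHom F) (repHom F.pres.Y) := by
    rw [Covers, map_repHom, ι_map_presHom]
    rfl
  have hhom : extendπ G _ ≫ (yonedaModCompExtend G).hom.app F.pres.Y = G.map (repHom F.pres.Y) :=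
    extendπ_desc G _ _
  rw [← cancel_epi ((yonedaModCompExtend G).hom.app F.pres.Y), ← extend_map_eq,
    ← cancel_epi (extendπ G ((yonedaMod C).obj F.pres.Y)), reassoc_of% hhom]
  exact extendπ_map G hcovers

lemma toExtend_map_presHom {c : C} {F : FPMod C} (b : c ⟶ F.pres.Y) :
    toExtend G ((yonedaMod C).map b ≫ presHom F) = G.map b ≫ extendπ G F := by
  rw [toExtend_map_comp, toExtend_presHom]

/-- A right exact functor extending `G` along the Yoneda functor sends `Coker Hom(-, f)` to
`Coker G(f)`, up to isomorphism and for any presenting morphism `f`. -/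
noncomputable def extendCokernelIso [Abelian (FPMod C)] [PreservesFiniteColimits (extend G)]
    {c' c : C} (f : c' ⟶ c) :
    (extend G).obj (cokernel ((yonedaMod C).map f)) ≅ cokernel (G.map f) :=
  PreservesCokernel.iso (extend G) ((yonedaMod C).map f) ≪≫
    cokernel.mapIso _ _ ((yonedaModCompExtend G).app c') ((yonedaModCompExtend G).app c)
      ((yonedaModCompExtend G).hom.naturality f)

end Extension

section Generating

/-- A functor `G : C ⥤ A` is generating if every object of `A` is a quotient of an object in the
image of `G`. For the inclusion of a full subcategory this is `Generates`. -/
def IsGenerating {C : Type u} [Category.{v} C] {A : Type u'} [Category.{v'} A] (G : C ⥤ A) :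
    Prop :=
  ∀ X : A, ∃ (c : C) (a : G.obj c ⟶ X), Epi a

variable {C : Type u} [Category.{v} C] {A : Type u'} [Category.{v'} A]

lemma generates_iff_isGenerating_ι (P : ObjectProperty A) : Generates P ↔ IsGenerating P.ι :=
  ⟨fun h X => let ⟨Y, g, hY, hg⟩ := h X; ⟨⟨Y, hY⟩, g, hg⟩,
    fun h X => let ⟨c, a, ha⟩ := h X; ⟨c.obj, a, c.property, ha⟩⟩

lemma IsGenerating.exists_iso_cokernel [Abelian A] {G : C ⥤ A} [G.Full] (hG : IsGenerating G)
    (X : A) : ∃ (c' c : C) (f : c' ⟶ c), Nonempty (cokernel (G.map f) ≅ X) := by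
  obtain ⟨c, a, _⟩ := hG X
  obtain ⟨c', a', _⟩ := hG (kernel a)
  obtain ⟨f, hf⟩ := G.map_surjective (a' ≫ kernel.ι a)
  have hX : cokernel (kernel.ι a) ≅ X := (cokernelIsCokernel _).coconePointUniqueUpToIso
    (Abelian.epiIsCokernelOfKernel _ (kernelIsKernel a))
  exact ⟨c', c, f, ⟨cokernelIsoOfEq hf ≪≫ cokernelEpiComp a' (kernel.ι a) ≪≫ hX⟩⟩

variable [Preadditive C] [Abelian A] {G : C ⥤ A} [G.Additive]

lemma isGenerating_of_essSurj_extend [(extend G).EssSurj] : IsGenerating G := fun X =>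
  let F := (extend G).objPreimage X
  ⟨F.pres.Y, extendπ G F ≫ ((extend G).objObjPreimageIso X).hom, epi_comp _ _⟩

namespace IsGenerating

variable [G.Full] (hG : IsGenerating G)

include hG

lemma exists_epi_comp_eq_toExtend {F : FPMod C} {T : A} (t : T ⟶ (extend G).obj F) :
    ∃ (c : C) (a : G.obj c ⟶ T) (x : (yonedaMod C).obj c ⟶ F),
      Epi a ∧ a ≫ t = toExtend G x := by
  obtain ⟨T', a, _, b, hb⟩ := surjective_up_to_refinements_of_epi (extendπ G F) t
  obtain ⟨c, a', _⟩ := hG T'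
  obtain ⟨b', hb'⟩ := G.map_surjective (a' ≫ b)
  refine ⟨c, a' ≫ a, (yonedaMod _).map b' ≫ presHom F, epi_comp _ _, ?_⟩
  rw [toExtend_map_presHom, hb', Category.assoc, hb, Category.assoc]

lemma exists_epi_extend_map_comp_eq {F F' : FPMod C}
    (θ : (extend G).obj F ⟶ (extend G).obj F') :
    ∃ (Z : FPMod C) (x : Z ⟶ F) (x' : Z ⟶ F'),
      Epi ((extend G).map x) ∧ (extend G).map x ≫ θ = (extend G).map x' := by
  obtain ⟨c, a, x', _, h⟩ := hG.exists_epi_comp_eq_toExtend (extendπ G F ≫ θ)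
  obtain ⟨b, rfl⟩ := G.map_surjective a
  refine ⟨_, (yonedaMod C).map b ≫ presHom F, x', ?_, ?_⟩
  · rw [extend_map_eq, toExtend_map_presHom]
    infer_instance
  · rw [extend_map_eq, extend_map_eq, toExtend_map_presHom, Category.assoc, Category.assoc, h]

variable [Abelian (FPMod C)]

lemma essSurj_extend [PreservesFiniteColimits (extend G)] : (extend G).EssSurj where
  mem_essImage X := by
    obtain ⟨_, _, f, ⟨e⟩⟩ := hG.exists_iso_cokernel X
    exact ⟨_, ⟨extendCokernelIso G f ≪≫ e⟩⟩

theorem isLocalization_extend [PreservesFiniteLimits (extend G)]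
    [PreservesFiniteColimits (extend G)] :
    (extend G).IsLocalization (extend G).kernel.isoModSerre :=
  have := hG.essSurj_extend
  isLocalization_isoModSerre_kernel _ fun _ _ => hG.exists_epi_extend_map_comp_eq

variable [G.Faithful]

lemma exists_epi_map_yonedaMod_map_comp_eq_zero {F : FPMod C} {c : C}
    (x : (yonedaMod C).obj c ⟶ F) (hx : toExtend G x = 0) :
    ∃ (c' : C) (a : c' ⟶ c), Epi (G.map a) ∧ (yonedaMod C).map a ≫ x = 0 := by
  obtain ⟨b, rfl⟩ := exists_yonedaMod_map_presHom x
  rw [toExtend_map_presHom] at hx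
  obtain ⟨T, a, _, k, hk⟩ :=
    (ShortComplex.exact_cokernel (G.map F.pres.f)).exact_up_to_refinements (G.map b) hx
  obtain ⟨c', a', _⟩ := hG T
  obtain ⟨k', hk'⟩ := G.map_surjective (a' ≫ k)
  obtain ⟨l, hl⟩ := G.map_surjective (a' ≫ a)
  have hlb : l ≫ b = k' ≫ F.pres.f := G.map_injective <| by
    rw [G.map_comp, G.map_comp, hl, hk', Category.assoc, Category.assoc]
    exact a' ≫= hk
  refine ⟨c', l, by rw [hl]; infer_instance, ?_⟩
  rw [← Category.assoc, ← Functor.map_comp, hlb, Functor.map_comp, Category.assoc,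
    yonedaMod_map_f_presHom, comp_zero]

lemma exact_map_extend {S : ShortComplex (FPMod C)} (hS : S.Exact) :
    (S.map (extend G)).Exact := by
  rw [ShortComplex.exact_iff_exact_up_to_refinements]
  intro T (t : T ⟶ (extend G).obj S.X₂) (ht : t ≫ (extend G).map S.g = 0)
  obtain ⟨c, a, x, _, hx⟩ := hG.exists_epi_comp_eq_toExtend t
  have hxg : toExtend G (x ≫ S.g) = 0 := by
    rw [toExtend_comp, ← hx, Category.assoc, ht, comp_zero]
  obtain ⟨c', a', _, ha'⟩ := hG.exists_epi_map_yonedaMod_map_comp_eq_zero _ hxg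
  rw [← Category.assoc] at ha'
  have hlift : (G.map a' ≫ a) ≫ t =
      toExtend G (hS.liftFromProjective _ ha') ≫ (extend G).map S.f := by
    rw [Category.assoc, hx, ← toExtend_map_comp, ← toExtend_comp, hS.liftFromProjective_comp]
  exact ⟨_, G.map a' ≫ a, epi_comp _ _, _, hlift⟩

theorem exact_extend : PreservesFiniteLimits (extend G) ∧ PreservesFiniteColimits (extend G) :=
  ((extend G).exact_tfae.out 1 3).1 fun _ => hG.exact_map_extend

end IsGenerating

end Generating

section Effaceable

variable {A : Type u} [Category.{v} A] [Abelian A]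

lemma eff_iff_epi_f {F : FPMod A} (p : Presentation ((FPMod.ι A).obj F)) : eff A F ↔ Epi p.f :=
  (isZero_extend_obj_iff (𝟭 A) F).trans (F.pres.epi_f_iff.trans p.epi_f_iff.symm)

lemma effRel_eq_kernel_extend (P : ObjectProperty A)
    [Abelian (FPMod P.FullSubcategory)] : effRel P = (extend P.ι).kernel := by
  ext F
  exact (eff_iff_epi_f (F := (inclMod P).obj F) (.ofCokernel (P.ι.map F.pres.f))).trans
    (isZero_extend_obj_iff P.ι F).symm

end Effaceable

end CoherentFunctor

theorem proposition3p4_general {A : Type u} [Category.{v} A] [Abelian A]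
    (P : ObjectProperty A) [Abelian (CoherentFunctor.FPMod P.FullSubcategory)] :
    CoherentFunctor.Generates P ↔
      PreservesFiniteLimits (CoherentFunctor.extend P.ι) ∧
      PreservesFiniteColimits (CoherentFunctor.extend P.ι) ∧
      ∃ _ : (CoherentFunctor.effRel P).IsSerreClass,
        (CoherentFunctor.extend P.ι).IsLocalization (CoherentFunctor.effRel P).isoModSerre := by
  rw [CoherentFunctor.generates_iff_isGenerating_ι]
  constructor
  · intro hP
    obtain ⟨hlim, hcolim⟩ := hP.exact_extend
    rw [CoherentFunctor.effRel_eq_kernel_extend]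
    exact ⟨hlim, hcolim, inferInstance, hP.isLocalization_extend⟩
  · rintro ⟨_, _, _, _⟩
    have := Localization.essSurj (CoherentFunctor.extend P.ι)
      (CoherentFunctor.effRel P).isoModSerre
    exact CoherentFunctor.isGenerating_of_essSurj_extend

theorem proposition3p4 {A : Type u} [Category.{v} A] [Abelian A]
    (P : ObjectProperty A) [HasFiniteBiproducts P.FullSubcategory]
    [Abelian (CoherentFunctor.FPMod P.FullSubcategory)] :
    CoherentFunctor.Generates P ↔
      PreservesFiniteLimits (CoherentFunctor.extend P.ι) ∧
      PreservesFiniteColimits (CoherentFunctor.extend P.ι) ∧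
      ∃ _ : (CoherentFunctor.effRel P).IsSerreClass,
        (CoherentFunctor.extend P.ι).IsLocalization (CoherentFunctor.effRel P).isoModSerre :=
  proposition3p4_general P
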